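/- Let $\mathbb{T}\subseteq\mathbb{R}$ be a time scale (a closed set) with at least two points, with forward and backward jump operators $\sigma,\rho$ and left graininess $\mu_\rho(t)=t-\rho(t)$; let $x^\Delta$ and $x^\nabla$ denote the delta and nabla derivatives on $\mathbb{T}$, and $[c,d]_{\mathbb{T}}=[c,d]\cap\mathbb{T}$. Let $a\le b$ be points of $\mathbb{T}$. Let $P(t)$, for $t\in[\rho(a),b]_{\mathbb{T}}$, be invertible Hermitian complex $n\times n$ matrices, and let $Q(t)$, for $t\in[a,b]_{\mathbb{T}}$, be Hermitian complex $n\times n$ matrices depending left-dense continuously on $t$ (outside these intervals the values of the matrix functions $P,Q$ on $\mathbb{T}$ are arbitrary). Let $\mathbb{D}$ be the set of all $n\times n$ complex matrix-valued functions $X$ on $\mathbb{T}$ such that $X^\Delta$ exists and is continuous at every point of $[\rho(a),b]_{\mathbb{T}}$ (as a function on the set of points of $\mathbb{T}$ where it exists), and such that $(PX^\Delta)^\nabla$ exists on $[a,b]_{\mathbb{T}}$ (in particular, $X^\Delta$ exists near each point of $[a,b]_{\mathbb{T}}$ in $\mathbb{T}$) and is left-dense continuous there. Let $X\in\mathbb{D}$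 and put, with $P^\rho(t)=P(\rho(t))$ and $P^{\rho-1}=(P^\rho)^{-1}$, $$Z=\begin{pmatrix}X\\ PX^\Delta\end{pmatrix},\qquad S=\begin{pmatrix}-\mu_\rho P^{\rho-1}Q & P^{\rho-1}\\ Q&0\end{pmatrix}.$$ Then $$-(PX^\Delta)^\nabla(t)+Q(t)X(t)=0\quad\text{for all }t\in[a,b]_{\mathbb{T}}$$ if and only if $Z$ is nabla differentiable on $[a,b]_{\mathbb{T}}$ and $$Z^\nabla(t)=S(t)Z(t)\quad\text{for all }t\in[a,b]_{\mathbb{T}}.$$ -/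

import Mathlib

open Filter Topology Set

namespace TimeScale

noncomputable section

/-- Forward jump operator `σ` of the time scale `T` (with `σ(max T) = max T`). -/
def fwdJump (T : Set ℝ) (t : ℝ) : ℝ :=
  open Classical in if ∃ s ∈ T, t < s then sInf {s | s ∈ T ∧ t < s} else t

/-- Backward jump operator `ρ` of the time scale `T` (with `ρ(min T) = min T`). -/
def bwdJump (T : Set ℝ) (t : ℝ) : ℝ :=
  open Classical in if ∃ s ∈ T, s < t then sSup {s | s ∈ T ∧ s < t} else t

/-- Left graininess `μ_ρ(t) = t - ρ(t)`. -/
def leftGraininess (T : Set ℝ) (t : ℝ) : ℝ := t - bwdJump T t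

/-- `T^κ`: the time scale without its maximum if that maximum is left-scattered. -/
def upperKappa (T : Set ℝ) : Set ℝ := {t ∈ T | ¬ (IsGreatest T t ∧ bwdJump T t < t)}

/-- `T_κ`: the time scale without its minimum if that minimum is right-scattered. -/
def lowerKappa (T : Set ℝ) : Set ℝ := {t ∈ T | ¬ (IsLeast T t ∧ t < fwdJump T t)}

/-- The time-scale interval `[a, b]_T = [a, b] ∩ T`. -/
def interval (T : Set ℝ) (a b : ℝ) : Set ℝ := Icc a b ∩ T

section Derivatives

variable {E : Type*} [AddCommGroup E] [Module ℝ E] [TopologicalSpace E]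

/-- `f` has delta derivative `d` at `t ∈ T^κ`: the quotients
`(f(σ(t)) - f(s)) / (σ(t) - s)` tend to `d` as `s → t`, `s ∈ T`, `s ≠ σ(t)`
(the value `s = t` is allowed when `t` is right-scattered). -/
def HasDeltaDerivAt (T : Set ℝ) (f : ℝ → E) (d : E) (t : ℝ) : Prop :=
  t ∈ upperKappa T ∧
    Tendsto (fun s => (fwdJump T t - s)⁻¹ • (f (fwdJump T t) - f s))
      (𝓝[T \ {fwdJump T t}] t) (𝓝 d)

/-- `f` has nabla derivative `d` at `t ∈ T_κ`: the quotients
`(f(s) - f(ρ(t))) / (s - ρ(t))` tend to `d` as `s → t`, `s ∈ T`, `s ≠ ρ(t)`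
(the value `s = t` is allowed when `t` is left-scattered). -/
def HasNablaDerivAt (T : Set ℝ) (f : ℝ → E) (d : E) (t : ℝ) : Prop :=
  t ∈ lowerKappa T ∧
    Tendsto (fun s => (s - bwdJump T t)⁻¹ • (f s - f (bwdJump T t)))
      (𝓝[T \ {bwdJump T t}] t) (𝓝 d)

/-- The set of points at which the delta derivative of `f` exists. -/
def deltaDomain (T : Set ℝ) (f : ℝ → E) : Set ℝ := {t | ∃ d, HasDeltaDerivAt T f d t}

/-- The set of points at which the nabla derivative of `f` exists. -/
def nablaDomain (T : Set ℝ) (f : ℝ → E) : Set ℝ := {t | ∃ d, HasNablaDerivAt T f d t}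

/-- The delta derivative `f^Δ`; only meaningful on `deltaDomain T f` (`0` elsewhere). -/
def deltaDeriv (T : Set ℝ) (f : ℝ → E) (t : ℝ) : E :=
  open Classical in if h : ∃ d, HasDeltaDerivAt T f d t then h.choose else 0

/-- The nabla derivative `f^∇`; only meaningful on `nablaDomain T f` (`0` elsewhere). -/
def nablaDeriv (T : Set ℝ) (f : ℝ → E) (t : ℝ) : E :=
  open Classical in if h : ∃ d, HasNablaDerivAt T f d t then h.choose else 0

end Derivatives

/-- `f` is left-dense continuous on `[a, b]_T`: continuous at the left-dense points (those
with `ρ(t) = t`, other than `min T`), with finite right-sided limits at the right-dense points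
(those with `σ(t) = t`, other than `max T`); all limits are taken within `[a, b]_T`. -/
def LdContinuousOn {E : Type*} [TopologicalSpace E] (T : Set ℝ) (f : ℝ → E) (a b : ℝ) : Prop :=
  ∀ t ∈ interval T a b,
    (bwdJump T t = t → ¬ IsLeast T t → ContinuousWithinAt f (interval T a b) t) ∧
    (fwdJump T t = t → ¬ IsGreatest T t →
      ∃ l, Tendsto f (𝓝[interval T a b ∩ Ioi t] t) (𝓝 l))

/-- The quasi-derivative `P X^Δ`. -/
def quasiDeriv {n : ℕ} (T : Set ℝ) (P X : ℝ → Matrix (Fin n) (Fin n) ℂ) :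
    ℝ → Matrix (Fin n) (Fin n) ℂ :=
  fun t => P t * deltaDeriv T X t

/-- The class `𝔻`. Functions on `T` are represented by functions on `ℝ` of which only the values
on `T` matter. `X^Δ` exists and is continuous at every point of `[ρ(a), b]_T`, as a function on
the set of points where it exists; at every `t ∈ [a, b]_T` the function `P X^Δ` is defined
near `t` in `T` and has a nabla derivative; and `(P X^Δ)^∇` is ld-continuous on `[a, b]_T`. -/
structure ClassD {n : ℕ} (T : Set ℝ) (a b : ℝ) (P X : ℝ → Matrix (Fin n) (Fin n) ℂ) : Prop where
  delta_exists : ∀ t ∈ interval T (bwdJump T a) b, t ∈ deltaDomain T X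
  delta_continuous : ∀ t ∈ interval T (bwdJump T a) b,
    ContinuousWithinAt (deltaDeriv T X) (deltaDomain T X) t
  delta_exists_near : ∀ t ∈ interval T a b, ∀ᶠ s in 𝓝[T] t, s ∈ deltaDomain T X
  nabla_exists : ∀ t ∈ interval T a b, t ∈ nablaDomain T (quasiDeriv T P X)
  nabla_ldContinuous : LdContinuousOn T (nablaDeriv T (quasiDeriv T P X)) a b

/-- `X` solves `-(P X^Δ)^∇ + Q X = 0` on `[a, b]_T` (for `X` in the class `𝔻`, where the
derivatives exist). -/
def SolvesSecondOrder {n : ℕ} (T : Set ℝ) (a b : ℝ) (P Q X : ℝ → Matrix (Fin n) (Fin n) ℂ) :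
    Prop :=
  ∀ t ∈ interval T a b, -nablaDeriv T (quasiDeriv T P X) t + Q t * X t = 0

/-- `Z = (X; P X^Δ)`, a `2n × n` matrix function. -/
def systemZ {n : ℕ} (T : Set ℝ) (P X : ℝ → Matrix (Fin n) (Fin n) ℂ) :
    ℝ → Matrix (Fin n ⊕ Fin n) (Fin n) ℂ :=
  fun t => Matrix.fromRows (X t) (quasiDeriv T P X t)

/-- The coefficient matrix `S = [[-μ_ρ (P^ρ)⁻¹ Q, (P^ρ)⁻¹], [Q, 0]]`. -/
def systemS {n : ℕ} (T : Set ℝ) (P Q : ℝ → Matrix (Fin n) (Fin n) ℂ) :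
    ℝ → Matrix (Fin n ⊕ Fin n) (Fin n ⊕ Fin n) ℂ :=
  fun t => Matrix.fromBlocks
    (-(leftGraininess T t • ((P (bwdJump T t))⁻¹ * Q t))) (P (bwdJump T t))⁻¹
    (Q t) 0

/-- `Z` solves the nabla system `Z^∇ = S Z` on `[a, b]_T`. -/
def SolvesNablaSystem {m k : Type*} [Fintype m] (T : Set ℝ) (a b : ℝ)
    (S : ℝ → Matrix m m ℂ) (Z : ℝ → Matrix m k ℂ) : Prop :=
  ∀ t ∈ interval T a b, HasNablaDerivAt T Z (S t * Z t) t

end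

end TimeScale

/-! The second row of `Z^∇ = S Z` is the second-order equation itself, by uniqueness of nabla
derivatives. Given the second row, the first holds automatically: `X^∇ = X^Δ ∘ ρ = (P^ρ)⁻¹ (P
X^Δ)^ρ`, and `(P X^Δ)^ρ = P X^Δ - μ_ρ (P X^Δ)^∇ = P X^Δ - μ_ρ Q X`.

The analytic content is `X^∇ = X^Δ ∘ ρ` (`hasNablaDerivAt_of_deltaDeriv`). It is delicate only at
left-dense, right-scattered points, where `X^Δ(t)` is the quotient across the right gap; continuity
of `X^Δ` and a mean value inequality carry it to the left. -/

namespace TimeScale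

/-! ### Jump operators and one-sided limits -/

section Jumps

variable {T : Set ℝ} {s t : ℝ}

theorem bwdJump_isLUB (h : ∃ s ∈ T, s < t) : IsLUB {s | s ∈ T ∧ s < t} (bwdJump T t) := by
  rw [bwdJump, if_pos h]
  exact isLUB_csSup h ⟨t, fun _ hs => hs.2.le⟩

theorem fwdJump_isGLB (h : ∃ s ∈ T, t < s) : IsGLB {s | s ∈ T ∧ t < s} (fwdJump T t) := by
  rw [fwdJump, if_pos h]
  exact isGLB_csInf h ⟨t, fun _ hs => hs.2.le⟩

theorem bwdJump_le (T : Set ℝ) (t : ℝ) : bwdJump T t ≤ t := by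
  by_cases h : ∃ s ∈ T, s < t
  · exact (bwdJump_isLUB h).2 fun _ hs => hs.2.le
  · rw [bwdJump, if_neg h]

theorem le_fwdJump (T : Set ℝ) (t : ℝ) : t ≤ fwdJump T t := by
  by_cases h : ∃ s ∈ T, t < s
  · exact (fwdJump_isGLB h).2 fun _ hs => hs.2.le
  · rw [fwdJump, if_neg h]

theorem le_bwdJump (hs : s ∈ T) (hst : s < t) : s ≤ bwdJump T t :=
  (bwdJump_isLUB ⟨s, hs, hst⟩).1 ⟨hs, hst⟩

theorem fwdJump_le (hs : s ∈ T) (hts : t < s) : fwdJump T t ≤ s :=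
  (fwdJump_isGLB ⟨s, hs, hts⟩).1 ⟨hs, hts⟩

theorem bwdJump_mem (hT : IsClosed T) (ht : t ∈ T) : bwdJump T t ∈ T := by
  by_cases h : ∃ s ∈ T, s < t
  · exact closure_minimal (fun _ hs => hs.1) hT ((bwdJump_isLUB h).mem_closure h)
  · rwa [bwdJump, if_neg h]

theorem fwdJump_mem (hT : IsClosed T) (ht : t ∈ T) : fwdJump T t ∈ T := by
  by_cases h : ∃ s ∈ T, t < s
  · exact closure_minimal (fun _ hs => hs.1) hT ((fwdJump_isGLB h).mem_closure h)
  · rwa [fwdJump, if_neg h]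

theorem fwdJump_bwdJump (ht : t ∈ T) (h : bwdJump T t < t) : fwdJump T (bwdJump T t) = t := by
  refine le_antisymm (fwdJump_le ht h) ((fwdJump_isGLB ⟨t, ht, h⟩).2 fun s hs => ?_)
  by_contra! hlt
  exact (le_bwdJump hs.1 hlt).not_gt hs.2

theorem bwdJump_mono (hs : s ∈ T) (hst : s ≤ t) : bwdJump T s ≤ bwdJump T t := by
  rcases hst.eq_or_lt with rfl | h
  · exact le_rfl
  · exact (bwdJump_le T s).trans (le_bwdJump hs h)

theorem nhdsWithin_Ioi_neBot_of_rightDense (h : ∃ s ∈ T, t < s) (ht : fwdJump T t = t) :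
    (𝓝[T ∩ Ioi t] t).NeBot := by
  have := (fwdJump_isGLB h).nhdsWithin_neBot h
  rwa [ht] at this

theorem nhdsWithin_Iio_neBot_of_leftDense (h : ∃ s ∈ T, s < t) (ht : bwdJump T t = t) :
    (𝓝[T ∩ Iio t] t).NeBot := by
  have := (bwdJump_isLUB h).nhdsWithin_neBot h
  rwa [ht] at this

/-- The filter in the definition of the nabla derivative is nontrivial on `T_κ`. -/
theorem nabla_filter_neBot (hT2 : T.Nontrivial) (ht : t ∈ lowerKappa T) :
    (𝓝[T \ {bwdJump T t}] t).NeBot := by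
  rcases (bwdJump_le T t).lt_or_eq with h | h
  · exact (pure_neBot (a := t)).mono (pure_le_nhdsWithin ⟨ht.1, h.ne'⟩)
  rw [h]
  by_cases hl : ∃ s ∈ T, s < t
  · have := nhdsWithin_Iio_neBot_of_leftDense hl h
    exact this.mono (nhdsWithin_mono _ fun s hs => ⟨hs.1, (show s < t from hs.2).ne⟩)
  · push Not at hl
    have hσ : fwdJump T t = t :=
      le_antisymm (not_lt.1 fun hlt => ht.2 ⟨⟨ht.1, hl⟩, hlt⟩) (le_fwdJump T t)
    obtain ⟨s, hs, hst⟩ := hT2.exists_ne t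
    have := nhdsWithin_Ioi_neBot_of_rightDense ⟨s, hs, lt_of_le_of_ne (hl s hs) hst.symm⟩ hσ
    exact this.mono (nhdsWithin_mono _ fun s hs => ⟨hs.1, (show t < s from hs.2).ne'⟩)

end Jumps

/-! ### Uniqueness of derivatives and increments across gaps -/

section Derivatives

variable {E : Type*} [AddCommGroup E] [Module ℝ E] [TopologicalSpace E] {T : Set ℝ} {f : ℝ → E}
  {d d' : E} {s t : ℝ}

theorem hasDeltaDerivAt_deltaDeriv (h : t ∈ deltaDomain T f) :
    HasDeltaDerivAt T f (deltaDeriv T f t) t := by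
  have h' : ∃ d, HasDeltaDerivAt T f d t := h
  rw [deltaDeriv, dif_pos h']
  exact h'.choose_spec

theorem hasNablaDerivAt_nablaDeriv (h : t ∈ nablaDomain T f) :
    HasNablaDerivAt T f (nablaDeriv T f t) t := by
  have h' : ∃ d, HasNablaDerivAt T f d t := h
  rw [nablaDeriv, dif_pos h']
  exact h'.choose_spec

theorem HasNablaDerivAt.unique [T2Space E] (hT2 : T.Nontrivial) (h : HasNablaDerivAt T f d t)
    (h' : HasNablaDerivAt T f d' t) : d = d' :=
  have := nabla_filter_neBot hT2 h.1
  tendsto_nhds_unique h.2 h'.2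

theorem HasDeltaDerivAt.eq_of_rightScattered [T2Space E] (h : HasDeltaDerivAt T f d t)
    (ht : t < fwdJump T t) : f (fwdJump T t) - f t = (fwdJump T t - t) • d := by
  -- Since `t ≠ σ(t)`, the value `s = t` is admissible, so the limit is the quotient at `t` itself.
  have h1 := h.2.mono_left (pure_le_nhdsWithin (s := T \ {fwdJump T t}) ⟨h.1.1, ht.ne⟩)
  have h2 := tendsto_nhds_unique h1 (tendsto_pure_nhds _ t)
  rw [h2, smul_inv_smul₀ (sub_pos.2 ht).ne']

theorem HasNablaDerivAt.eq_of_leftScattered [T2Space E] (h : HasNablaDerivAt T f d t)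
    (ht : bwdJump T t < t) : f t - f (bwdJump T t) = (t - bwdJump T t) • d := by
  have h1 := h.2.mono_left (pure_le_nhdsWithin (s := T \ {bwdJump T t}) ⟨h.1.1, ht.ne'⟩)
  have h2 := tendsto_nhds_unique h1 (tendsto_pure_nhds _ t)
  rw [h2, smul_inv_smul₀ (sub_pos.2 ht).ne']

/-- `f(t) - f(ρ(t)) = μ_ρ(t) f^∇(t)`. -/
theorem HasNablaDerivAt.sub_bwdJump [T2Space E] (h : HasNablaDerivAt T f d t) :
    f t - f (bwdJump T t) = leftGraininess T t • d := by
  rcases (bwdJump_le T t).lt_or_eq with ht | ht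
  · exact h.eq_of_leftScattered ht
  · simp [leftGraininess, ht]

end Derivatives

/-! ### Mean value inequality and the identity `f^∇ = f^Δ ∘ ρ` -/

section Normed

variable {E : Type*} [NormedAddCommGroup E] [NormedSpace ℝ E] {T : Set ℝ} {f : ℝ → E}
  {d : E} {s t : ℝ}

/-- Solve the difference quotient for `f s` and let `s → t`. Excluding `σ(t)` costs nothing: it is
away from `t` or equal to `t`. -/
theorem HasDeltaDerivAt.continuousWithinAt (h : HasDeltaDerivAt T f d t) :
    ContinuousWithinAt f T t := by
  have hc : Tendsto (fun s => fwdJump T t - s) (𝓝[T \ {fwdJump T t}] t)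
      (𝓝 (fwdJump T t - t)) :=
    (continuous_const.sub continuous_id).continuousAt.tendsto.mono_left nhdsWithin_le_nhds
  have h1 : Tendsto f (𝓝[T \ {fwdJump T t}] t)
      (𝓝 (f (fwdJump T t) - (fwdJump T t - t) • d)) := by
    refine (tendsto_const_nhds.sub (hc.smul h.2)).congr' ?_
    filter_upwards [self_mem_nhdsWithin] with s hs
    rw [smul_inv_smul₀ (sub_ne_zero.2 fun e => hs.2 e.symm), sub_sub_cancel]
  rcases (le_fwdJump T t).lt_or_eq with ht | ht
  · rw [← h.eq_of_rightScattered ht, sub_sub_cancel] at h1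
    refine h1.mono_left (nhdsWithin_le_of_mem ?_)
    filter_upwards [self_mem_nhdsWithin, mem_nhdsWithin_of_mem_nhds (Iio_mem_nhds ht)] with s hs hlt
    exact ⟨hs, (show s < _ from hlt).ne⟩
  · rw [← ht, sub_self, zero_smul, sub_zero] at h1
    exact continuousWithinAt_sdiff_self.1 h1

/-- Mean value inequality on a time scale. -/
theorem norm_sub_sub_smul_le_of_deltaDeriv {f' : ℝ → E} {ε : ℝ} (hT : IsClosed T)
    (hs : s ∈ T) (ht : t ∈ T) (hst : s ≤ t)
    (hf : ∀ r ∈ interval T s t, HasDeltaDerivAt T f (f' r) r)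
    (hbound : ∀ r ∈ interval T s t, ‖f' r - d‖ < ε) :
    ‖f t - f s - (t - s) • d‖ ≤ ε * (t - s) := by
  set A : Set ℝ := {r | r ∈ interval T s t ∧ ‖f r - f s - (r - s) • d‖ ≤ ε * (r - s)} with hA
  have hI : IsClosed (interval T s t) := isClosed_Icc.inter hT
  have hcont : ContinuousOn f (interval T s t) := fun r hr =>
    (hf r hr).continuousWithinAt.mono inter_subset_right
  have hclosed : IsClosed A := by
    refine hI.isClosed_le (f := fun r => ‖f r - f s - (r - s) • d‖) (g := fun r => ε * (r - s))
      ?_ ?_ <;> fun_prop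
  have step : ∀ x y, x ∈ A → y ∈ interval T s t →
      ‖f y - f x - (y - x) • d‖ ≤ ε * (y - x) → y ∈ A := by
    intro x y hx hy hxy
    refine ⟨hy, ?_⟩
    have e : f y - f s - (y - s) • d
        = (f y - f x - (y - x) • d) + (f x - f s - (x - s) • d) := by
      module
    rw [e]
    exact (norm_add_le _ _).trans (by linarith [hx.2])
  have key : t ∈ A := by
    -- Induction along the time scale: `A` is closed, and from each of its points below `t` it
    -- reaches further right, to `σ(x)` across a gap or to a nearby point if `x` is right-dense.
    refine (hclosed.inter isClosed_Icc).mem_of_ge_of_forall_exists_gt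
      ⟨⟨⟨le_rfl, hst⟩, hs⟩, by simp⟩ hst ?_
    rintro x ⟨hxA, hxs, hxt⟩
    have hx := hf x hxA.1
    have hb := hbound x hxA.1
    rcases (le_fwdJump T x).lt_or_eq with hσ | hσ
    · have hle := fwdJump_le ht hxt
      refine ⟨fwdJump T x, step x _ hxA ⟨⟨hxs.trans hσ.le, hle⟩, fwdJump_mem hT hxA.1.2⟩ ?_,
        hσ, hle⟩
      rw [hx.eq_of_rightScattered hσ, ← smul_sub, norm_smul, Real.norm_of_nonneg (by linarith),
        mul_comm]
      exact mul_le_mul_of_nonneg_right hb.le (by linarith)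
    · have := nhdsWithin_Ioi_neBot_of_rightDense ⟨t, ht, hxt⟩ hσ.symm
      have hlim := hx.2.sub_const d |>.norm
      rw [← hσ] at hlim
      have hlim' := hlim.mono_left (nhdsWithin_mono x
        (fun r hr => ⟨hr.1, (show x < r from hr.2).ne'⟩ : T ∩ Ioi x ⊆ T \ {x}))
      obtain ⟨y, ⟨hyε, hyT, hxy⟩, hyt⟩ := ((hlim'.eventually_lt_const hb).and
        self_mem_nhdsWithin |>.and (mem_nhdsWithin_of_mem_nhds (Iio_mem_nhds hxt))).exists
      replace hxy : x < y := hxy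
      replace hyt : y < t := hyt
      refine ⟨y, step x y hxA ⟨⟨hxs.trans hxy.le, hyt.le⟩, hyT⟩ ?_, hxy, hyt.le⟩
      have e : f y - f x - (y - x) • d = (y - x) • ((x - y)⁻¹ • (f x - f y) - d) := by
        rw [smul_sub, ← neg_sub y x, inv_neg, neg_smul, smul_neg,
          smul_inv_smul₀ (sub_pos.2 hxy).ne', neg_sub]
      rw [e, norm_smul, Real.norm_of_nonneg (by linarith), mul_comm]
      exact mul_le_mul_of_nonneg_right hyε.le (by linarith)
  exact key.2

/-- If `f^Δ` exists near `t` and is continuous at `t`, and `f^Δ(ρ(t))` exists, then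
`f^∇(t) = f^Δ(ρ(t))`. -/
theorem hasNablaDerivAt_of_deltaDeriv (hT : IsClosed T) (ht : t ∈ lowerKappa T)
    (hρ : bwdJump T t ∈ deltaDomain T f) (hnear : ∀ᶠ s in 𝓝[T] t, s ∈ deltaDomain T f)
    (hcont : ContinuousWithinAt (deltaDeriv T f) (deltaDomain T f) t) :
    HasNablaDerivAt T f (deltaDeriv T f (bwdJump T t)) t := by
  refine ⟨ht, ?_⟩
  have hdt := hasDeltaDerivAt_deltaDeriv (mem_of_mem_nhdsWithin ht.1 hnear)
  have hdρ := hasDeltaDerivAt_deltaDeriv hρ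
  rcases (bwdJump_le T t).lt_or_eq with h | h
  -- Left-scattered: `σ(ρ(t)) = t`, so both derivatives are the quotient across the same gap.
  · have hσ := fwdJump_bwdJump ht.1 h
    have e := hdρ.eq_of_rightScattered (by rwa [hσ])
    rw [hσ] at e
    have hne : t - bwdJump T t ≠ 0 := (sub_pos.2 h).ne'
    have e' : deltaDeriv T f (bwdJump T t) = (t - bwdJump T t)⁻¹ • (f t - f (bwdJump T t)) := by
      rw [e, inv_smul_smul₀ hne]
    rw [e']
    have hf : Tendsto f (𝓝[T \ {bwdJump T t}] t) (𝓝 (f t)) :=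
      hdt.continuousWithinAt.mono sdiff_subset
    have hc : Tendsto (fun s => s - bwdJump T t) (𝓝[T \ {bwdJump T t}] t)
        (𝓝 (t - bwdJump T t)) :=
      (continuous_id.sub continuous_const).continuousAt.tendsto.mono_left nhdsWithin_le_nhds
    exact (hc.inv₀ hne).smul (hf.sub_const _)
  rw [h]
  rcases (le_fwdJump T t).lt_or_eq with hσ | hσ
  -- The quotient defining `f^Δ(t)` says nothing about points to the left. As no point of `T` lies
  -- between `t` and `σ(t)`, nearby `s ≠ t` satisfy `s < t`, and the mean value inequality applies
  -- on `[s, t]`. The `ε / 2` makes the final bound strict.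
  · rw [Metric.tendsto_nhds]
    intro ε hε
    have hlim : Tendsto (deltaDeriv T f) (𝓝[T] t) (𝓝 (deltaDeriv T f t)) :=
      hcont.mono_left (nhdsWithin_le_iff.2 hnear)
    have hev := hnear.and ((Metric.tendsto_nhds.1 hlim) (ε / 2) (half_pos hε))
    obtain ⟨δ, hδ, hball⟩ := Metric.mem_nhdsWithin_iff.1 hev
    filter_upwards [self_mem_nhdsWithin, mem_nhdsWithin_of_mem_nhds (Iio_mem_nhds hσ),
      mem_nhdsWithin_of_mem_nhds (Metric.ball_mem_nhds t hδ)] with s hs hsσ hsδ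
    have hst : s < t := by
      rcases lt_trichotomy s t with h1 | h1 | h1
      · exact h1
      · exact absurd h1 hs.2
      · exact absurd hsσ (not_lt.2 (fwdJump_le hs.1 h1))
    have hr : ∀ r ∈ interval T s t, r ∈ Metric.ball t δ ∩ T := by
      rintro r ⟨⟨h1, h2⟩, h3⟩
      rw [Metric.mem_ball, Real.dist_eq, abs_lt] at hsδ
      refine ⟨?_, h3⟩
      rw [Metric.mem_ball, Real.dist_eq, abs_lt]
      constructor <;> linarith
    have hmv := norm_sub_sub_smul_le_of_deltaDeriv hT hs.1 ht.1 hst.le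
      (fun r hr' => hasDeltaDerivAt_deltaDeriv (hball (hr r hr')).1)
      (fun r hr' => by simpa only [dist_eq_norm] using (hball (hr r hr')).2)
    have hpos : 0 < t - s := sub_pos.2 hst
    have e : (s - t)⁻¹ • (f s - f t) - deltaDeriv T f t
        = (t - s)⁻¹ • (f t - f s - (t - s) • deltaDeriv T f t) := by
      rw [smul_sub (t - s)⁻¹, inv_smul_smul₀ hpos.ne', ← neg_sub t s, ← neg_sub (f t), inv_neg,
        neg_smul, smul_neg, neg_neg]
    rw [dist_eq_norm, e, norm_smul, norm_inv, Real.norm_of_nonneg hpos.le,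
      inv_mul_lt_iff₀ hpos]
    nlinarith
  -- Here `ρ(t) = t = σ(t)`, and the two quotients agree up to two signs.
  · have := hdt.2
    rw [← hσ] at this
    refine this.congr fun s => ?_
    rw [← neg_sub s t, ← neg_sub (f s), inv_neg, neg_smul, smul_neg, neg_neg]

end Normed

/-! ### Block rows of the nabla system -/

section Matrices

theorem tendsto_fromRows_iff {α R m₁ m₂ k : Type*} [TopologicalSpace R] {l : Filter α}
    {A : α → Matrix m₁ k R} {B : α → Matrix m₂ k R} {A₀ : Matrix m₁ k R} {B₀ : Matrix m₂ k R} :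
    Tendsto (fun x => Matrix.fromRows (A x) (B x)) l (𝓝 (Matrix.fromRows A₀ B₀)) ↔
      Tendsto A l (𝓝 A₀) ∧ Tendsto B l (𝓝 B₀) := by
  refine tendsto_pi_nhds.trans (Sum.forall.trans (and_congr ?_ ?_)) <;>
    exact tendsto_pi_nhds.symm

theorem hasNablaDerivAt_fromRows_iff {m₁ m₂ k : Type*} {T : Set ℝ} {t : ℝ}
    {A : ℝ → Matrix m₁ k ℂ} {B : ℝ → Matrix m₂ k ℂ} {A' : Matrix m₁ k ℂ} {B' : Matrix m₂ k ℂ} :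
    HasNablaDerivAt T (fun s => Matrix.fromRows (A s) (B s)) (Matrix.fromRows A' B') t ↔
      HasNablaDerivAt T A A' t ∧ HasNablaDerivAt T B B' t := by
  have e : (fun s => (s - bwdJump T t)⁻¹ • (Matrix.fromRows (A s) (B s)
        - Matrix.fromRows (A (bwdJump T t)) (B (bwdJump T t))))
      = fun s => Matrix.fromRows ((s - bwdJump T t)⁻¹ • (A s - A (bwdJump T t)))
        ((s - bwdJump T t)⁻¹ • (B s - B (bwdJump T t))) := by
    funext s
    ext i j
    cases i <;> rfl
  unfold HasNablaDerivAt
  rw [e, tendsto_fromRows_iff]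
  tauto

/-- Grouped so that, once `Q X = (P X^Δ)^∇`, the bracket in the top row becomes `(P X^Δ)^ρ`. -/
theorem systemS_mul_systemZ {n : ℕ} (T : Set ℝ) (P Q X : ℝ → Matrix (Fin n) (Fin n) ℂ) (t : ℝ) :
    systemS T P Q t * systemZ T P X t = Matrix.fromRows
      ((P (bwdJump T t))⁻¹ * (quasiDeriv T P X t - leftGraininess T t • (Q t * X t)))
      (Q t * X t) := by
  rw [systemS, systemZ, ← Matrix.fromRows_fromCols_eq_fromBlocks, Matrix.fromRows_mul,
    Matrix.fromCols_mul_fromRows, Matrix.fromCols_mul_fromRows, Matrix.zero_mul, add_zero]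
  congr 1
  rw [mul_sub, Matrix.neg_mul, Matrix.smul_mul, Matrix.mul_smul, Matrix.mul_assoc]
  abel

theorem ClassD.hasNablaDerivAt {n : ℕ} {T : Set ℝ} (hT : IsClosed T) {a b : ℝ}
    (ha : a ∈ T) {P X : ℝ → Matrix (Fin n) (Fin n) ℂ}
    (hPinv : ∀ t ∈ interval T (bwdJump T a) b, IsUnit (P t)) (hX : ClassD T a b P X) {t : ℝ}
    (ht : t ∈ interval T a b) :
    HasNablaDerivAt T X ((P (bwdJump T t))⁻¹ * quasiDeriv T P X (bwdJump T t)) t := by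
  have htρ : t ∈ interval T (bwdJump T a) b := ⟨⟨(bwdJump_le T a).trans ht.1.1, ht.1.2⟩, ht.2⟩
  have hρ : bwdJump T t ∈ interval T (bwdJump T a) b :=
    ⟨⟨bwdJump_mono ha ht.1.1, (bwdJump_le T t).trans ht.1.2⟩, bwdJump_mem hT ht.2⟩
  have hκ := (hasNablaDerivAt_nablaDeriv (hX.nabla_exists t ht)).1
  rw [quasiDeriv, Matrix.nonsing_inv_mul_cancel_left _ _
    ((Matrix.isUnit_iff_isUnit_det _).1 (hPinv _ hρ))]
  -- The entrywise sup norm induces the topology already used for the derivatives, so the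
  -- normed-space result applies.
  let := Matrix.normedAddCommGroup (m := Fin n) (n := Fin n) (α := ℂ)
  let := Matrix.normedSpace (m := Fin n) (n := Fin n) (R := ℝ) (α := ℂ)
  exact hasNablaDerivAt_of_deltaDeriv hT hκ (hX.delta_exists _ hρ) (hX.delta_exists_near t ht)
    (hX.delta_continuous t htρ)

theorem ClassD.hasNablaDerivAt_systemZ_iff {n : ℕ} {T : Set ℝ} (hT : IsClosed T)
    (hT2 : T.Nontrivial) {a b : ℝ} (ha : a ∈ T) {P X : ℝ → Matrix (Fin n) (Fin n) ℂ}
    (Q : ℝ → Matrix (Fin n) (Fin n) ℂ)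
    (hPinv : ∀ t ∈ interval T (bwdJump T a) b, IsUnit (P t)) (hX : ClassD T a b P X) {t : ℝ}
    (ht : t ∈ interval T a b) :
    HasNablaDerivAt T (systemZ T P X) (systemS T P Q t * systemZ T P X t) t ↔
      -nablaDeriv T (quasiDeriv T P X) t + Q t * X t = 0 := by
  have hq := hasNablaDerivAt_nablaDeriv (hX.nabla_exists t ht)
  rw [systemS_mul_systemZ, neg_add_eq_zero]
  refine hasNablaDerivAt_fromRows_iff.trans ⟨fun h => hq.unique hT2 h.2, fun h => ?_⟩
  rw [h] at hq
  refine ⟨?_, hq⟩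
  -- Now `Q X` is the nabla derivative of `P X^Δ`, so subtracting `μ_ρ Q X` shifts `P X^Δ` back to
  -- `ρ(t)`.
  rw [← hq.sub_bwdJump, sub_sub_cancel]
  exact hX.hasNablaDerivAt hT ha hPinv ht

end Matrices

end TimeScale

theorem mainTheorem10 {n : ℕ} (T : Set ℝ) (hT : IsClosed T) (hT2 : T.Nontrivial)
    (a b : ℝ) (ha : a ∈ T) (hb : b ∈ T) (hab : a ≤ b)
    (P Q : ℝ → Matrix (Fin n) (Fin n) ℂ)
    (hPherm : ∀ t ∈ TimeScale.interval T (TimeScale.bwdJump T a) b, (P t).IsHermitian)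
    (hPinv : ∀ t ∈ TimeScale.interval T (TimeScale.bwdJump T a) b, IsUnit (P t))
    (hQherm : ∀ t ∈ TimeScale.interval T a b, (Q t).IsHermitian)
    (hQld : TimeScale.LdContinuousOn T Q a b)
    (X : ℝ → Matrix (Fin n) (Fin n) ℂ) (hX : TimeScale.ClassD T a b P X) :
    TimeScale.SolvesSecondOrder T a b P Q X ↔
      TimeScale.SolvesNablaSystem T a b (TimeScale.systemS T P Q)
        (TimeScale.systemZ T P X) := by
  exact forall₂_congr fun _ ht => (hX.hasNablaDerivAt_systemZ_iff hT hT2 ha Q hPinv ht).symm
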